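/- Let $N\ge 1$ be an integer and let $\mathbb T$ be the unit circle. Write $L^2,L^\infty$ and $H^2,H^\infty$ for the Lebesgue and Hardy spaces on $\mathbb T$, put $\overline{H^\infty}:=\{f\in L^\infty:\overline f\in H^\infty\}$, and let $X_N$, $X_{N\times N}$ denote vectors and matrices with entries in $X$. For an algebra $\mathcal A$, $G\mathcal A_{N\times N}$ denotes the set of matrices in $\mathcal A_{N\times N}$ that have an inverse in $\mathcal A_{N\times N}$. Let $P$ be the Riesz projection of $L^2$ onto $H^2$ (acting elementwise on $L^2_N$), $Q:=I-P$, $\widetilde a(t):=a(1/t)$ and $(Jf)(t):=t^{-1}f(1/t)$. For $a\in L^\infty_{N\times N}$ the Hankel operator on $H^2_N$ is $H(a):=PaQJ|_{H_N^2}$. For a bounded operator $K$ on a Hilbert space $H$ and $n\ge 0$ let $s_n(K):=\inf\{\|K-F\|: F \text{ bounded},\ \operatorname{rank}F\le n\}$; for $1\le p<\infty$, $K\in\mathcal C_p(H)$ means $\sum_{n\ge0}s_n(K)^p<\infty$. A function $\omega:(0,\pi]\to(0,\infty)$ belongs to the Bari–Stechkin class if it is almost increasing (there is $A>0$ with $\omega(x)\le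 A\,\omega(y)$ whenever $0<x\le y\le\pi$), $\lim_{x\to0+}\omega(x)=0$, and $$\sup_{0<x\le\pi}\frac1{\omega(x)}\int_0^x\frac{\omega(y)}y\,dy<\infty,\qquad \sup_{0<x\le\pi}\frac x{\omega(x)}\int_x^\pi\frac{\omega(y)}{y^2}\,dy<\infty .$$ For such $\omega$, $\mathcal H^\omega$ is the set of continuous $f:\mathbb T\to\mathbb C$ with $\sup_{0<x\le\pi}\omega(f,x)/\omega(x)<\infty$, where $\omega(f,x):=\sup_{|h|\le x}\sup_{y\in\mathbb R}|f(e^{i(y+h)})-f(e^{iy})|$. **Lemma.** Let $1\le p<\infty$, let $\omega,\psi$ belong to the Bari–Stechkin class, and suppose $$\sum_{k=1}^\infty\left[\omega\left(\frac1k\right)\psi\left(\frac1k\right)\right]^p<\infty .$$ Let $u_-\in G(\mathcal H^\omega\cap\overline{H^\infty})_{N\times N}$ and $u_+\in G(\mathcal H^\psi\cap H^\infty)_{N\times N}$. (a) If $a\in L^\infty_{N\times N}$ satisfies $a=u_-u_+$, then $H(a)H(\widetilde a^{-1})\in\mathcal C_p(H^2_N)$. (b) If $v_-\in(\overline{H^\infty})_{N\times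 N}$, $v_+\in H^\infty_{N\times N}$, $b:=v_-u_+^{-1}$ and $c:=u_-^{-1}v_+$, then $H(\widetilde c)H(b)$ and $H(b)H(\widetilde c)$ belong to $\mathcal C_p(H^2_N)$. -/

import Mathlib

open MeasureTheory AddCircle
open scoped ENNReal Real

noncomputable section

namespace HankelProduct

/-! ### Schatten–von Neumann classes -/

section Schatten

variable {H : Type*} [NormedAddCommGroup H] [InnerProductSpace ℂ H]

/-- The approximation number `s_n(A)`: the distance, in operator norm, from `A` to the bounded
operators of rank at most `n`. -/
def approxNumber (A : H →L[ℂ] H) (n : ℕ) : ℝ :=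
  sInf {r : ℝ | ∃ F : H →L[ℂ] H, (F : H →ₗ[ℂ] H).rank ≤ (n : Cardinal) ∧ r = ‖A - F‖}

/-- Membership of `K` in the Schatten–von Neumann class `C_p(H)`:
`∑_{n ≥ 0} s_n(K)^p < ∞`. -/
def IsSchatten (p : ℝ) (K : H →L[ℂ] H) : Prop :=
  Summable fun n : ℕ => approxNumber K n ^ p

end Schatten

/-! ### The Bari–Stechkin class -/

/-- `φ` is almost increasing on `I`. -/
def AlmostIncreasingOn (φ : ℝ → ℝ) (I : Set ℝ) : Prop :=
  ∃ A : ℝ, 0 < A ∧ ∀ x ∈ I, ∀ y ∈ I, x ≤ y → φ x ≤ A * φ y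

/-- The Bari–Stechkin class. Only the values of `ω` on `(0, π]` matter; the integrals occurring
in the definition are required to exist. -/
structure BariStechkin (ω : ℝ → ℝ) : Prop where
  almostIncreasing : AlmostIncreasingOn ω (Set.Ioc 0 π)
  pos : ∀ x ∈ Set.Ioc (0 : ℝ) π, 0 < ω x
  tendsto_zero : Filter.Tendsto ω (nhdsWithin 0 (Set.Ioi 0)) (nhds 0)
  integrable_div : IntegrableOn (fun y => ω y / y) (Set.Ioc 0 π)
  integral_div_le : ∃ C : ℝ, ∀ x ∈ Set.Ioc (0 : ℝ) π,
    1 / ω x * ∫ y in Set.Ioc 0 x, ω y / y ≤ C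
  integrable_div_sq : ∀ x ∈ Set.Ioc (0 : ℝ) π,
    IntegrableOn (fun y => ω y / y ^ 2) (Set.Ioc x π)
  integral_div_sq_le : ∃ C : ℝ, ∀ x ∈ Set.Ioc (0 : ℝ) π,
    x / ω x * ∫ y in Set.Ioc x π, ω y / y ^ 2 ≤ C

/-! ### The unit circle and generalized Hölder functions -/

instance fact_two_pi_pos : Fact ((0 : ℝ) < 2 * π) := ⟨Real.two_pi_pos⟩

/-- The unit circle, parametrized as `t = e^{iθ}` with `θ ∈ ℝ / 2πℤ`. In this parametrization the
function `t ↦ t ^ k` is `fourier k`, and `t ↦ 1 / t` is `θ ↦ -θ`. -/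
abbrev Torus : Type := AddCircle (2 * π)

/-- Normalized Lebesgue measure `dθ / 2π` on the circle. -/
abbrev torusMeasure : Measure Torus := haarAddCircle

/-- The modulus of continuity
`ω(f, x) = sup_{|h| ≤ x} sup_y |f(e^{i(y+h)}) - f(e^{iy})|`. -/
def modulus (f : Torus → ℂ) (x : ℝ) : ℝ :=
  sSup {r : ℝ | ∃ h y : ℝ, |h| ≤ x ∧ r = ‖f ((y + h : ℝ) : Torus) - f (y : Torus)‖}

/-- The continuous function `f` belongs to the generalized Hölder space: the quotient
`ω(f, x) / ω(x)` is bounded for `0 < x ≤ π`. -/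
def IsGenHolder (ω : ℝ → ℝ) (f : C(Torus, ℂ)) : Prop :=
  BddAbove {r : ℝ | ∃ x ∈ Set.Ioc (0 : ℝ) π, r = modulus f x / ω x}

/-! ### The algebra `L^∞` and its subsets -/

/-- Classes of measurable functions on the circle form a commutative ring under the pointwise
operations of Mathlib. -/
instance instCommRingMeasurable : CommRing (Torus →ₘ[torusMeasure] ℂ) where
  __ := (inferInstance : AddCommGroup (Torus →ₘ[torusMeasure] ℂ))
  __ := (inferInstance : CommMonoid (Torus →ₘ[torusMeasure] ℂ))
  left_distrib f g h := AEEqFun.toGerm_injective <| by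
    simp only [AEEqFun.mul_toGerm, AEEqFun.add_toGerm, mul_add]
  right_distrib f g h := AEEqFun.toGerm_injective <| by
    simp only [AEEqFun.mul_toGerm, AEEqFun.add_toGerm, add_mul]
  zero_mul f := AEEqFun.toGerm_injective <| by
    simp only [AEEqFun.mul_toGerm, AEEqFun.zero_toGerm, zero_mul]
  mul_zero f := AEEqFun.toGerm_injective <| by
    simp only [AEEqFun.mul_toGerm, AEEqFun.zero_toGerm, mul_zero]

/-- The algebra `L^∞` of (classes of) essentially bounded measurable functions on the circle. -/
def LInf : Subring (Torus →ₘ[torusMeasure] ℂ) where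
  carrier := {f | f ∈ Lp ℂ ∞ torusMeasure}
  mul_mem' {f g} hf hg := by
    have hf' := Lp.mem_Lp_iff_memLp.1 hf
    have hg' := Lp.mem_Lp_iff_memLp.1 hg
    exact Lp.mem_Lp_iff_memLp.2 ((memLp_congr_ae (AEEqFun.coeFn_mul f g)).2 (hg'.mul hf'))
  one_mem' := Lp.mem_Lp_iff_memLp.2
    ((memLp_congr_ae AEEqFun.coeFn_one).2 (memLp_const (1 : ℂ)))
  add_mem' hf hg := (Lp ℂ ∞ torusMeasure).add_mem hf hg
  zero_mem' := (Lp ℂ ∞ torusMeasure).zero_mem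
  neg_mem' hf := (Lp ℂ ∞ torusMeasure).neg_mem hf

/-- An element of the algebra `L^∞`, seen in Mathlib's Banach space `L^∞`. -/
def toLpTop (φ : LInf) : Lp ℂ ∞ torusMeasure := ⟨φ.1, φ.2⟩

/-- The class in `L^∞` of a continuous function. -/
def ofContinuous (f : C(Torus, ℂ)) : LInf :=
  ⟨(ContinuousMap.toLp ∞ torusMeasure ℂ f : Lp ℂ ∞ torusMeasure).1,
    (ContinuousMap.toLp ∞ torusMeasure ℂ f : Lp ℂ ∞ torusMeasure).2⟩

/-- The reflection `θ ↦ -θ`, that is `t ↦ 1 / t`, preserves the measure. -/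
theorem measurePreserving_refl :
    MeasurePreserving (fun θ : Torus => -θ) torusMeasure torusMeasure :=
  Measure.measurePreserving_neg torusMeasure

/-- `φ̃(t) = φ(1 / t)` on `L^∞`. -/
def tilde (φ : LInf) : LInf :=
  ⟨(Lp.compMeasurePreserving (fun θ : Torus => -θ) measurePreserving_refl (toLpTop φ)).1,
    (Lp.compMeasurePreserving (fun θ : Torus => -θ) measurePreserving_refl (toLpTop φ)).2⟩

/-- The Hardy space `H^∞`: the functions in `L^∞` whose Fourier coefficients of negative index
vanish. -/
def HInf : Set LInf := {f | ∀ k : ℤ, k < 0 → fourierCoeff (f.1 : Torus → ℂ) k = 0}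

/-- The functions in `L^∞` whose complex conjugate belongs to `H^∞`. -/
def HInfBar : Set LInf :=
  {f | ∀ k : ℤ, k < 0 → fourierCoeff (fun t : Torus => starRingEnd ℂ (f.1 t)) k = 0}

/-- The generalized Hölder space, as a subset of `L^∞`. -/
def GenHolder (ω : ℝ → ℝ) : Set LInf :=
  {f | ∃ g : C(Torus, ℂ), IsGenHolder ω g ∧ f = ofContinuous g}

/-- The algebra `L^∞_{N×N}` of matrix symbols. -/
abbrev MatSymbol (N : ℕ) : Type := Matrix (Fin N) (Fin N) LInf

variable {N : ℕ}

/-- All entries of the matrix function `u` lie in `S`. -/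
def EntriesIn (S : Set LInf) (u : MatSymbol N) : Prop := ∀ i j, u i j ∈ S

/-- `u ∈ G S_{N×N}`: the matrix function `u` has entries in `S` and has a two-sided inverse with
entries in `S`. -/
def InvertibleIn (S : Set LInf) (u : MatSymbol N) : Prop :=
  EntriesIn S u ∧ ∃ w : MatSymbol N, EntriesIn S w ∧ u * w = 1 ∧ w * u = 1

/-- `ã(t) = a(1 / t)` on matrix functions. -/
def symbolTilde (a : MatSymbol N) : MatSymbol N := Matrix.map a tilde

/-! ### Operators on `L²_N` -/

/-- The space `L²` of the circle. -/
abbrev L2 : Type := Lp ℂ 2 torusMeasure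

/-- Multiplication by an element of `L^∞` on `L²`. -/
def mulOp (φ : LInf) : L2 →L[ℂ] L2 :=
  (ContinuousLinearMap.mul ℂ ℂ).holderL torusMeasure ∞ 2 2 (toLpTop φ)

/-- The Hardy space `H²`: the functions in `L²` whose Fourier coefficients of negative index
vanish. -/
def H2 : Submodule ℂ L2 where
  carrier := {f | ∀ k : ℤ, k < 0 → fourierCoeff (f : Torus → ℂ) k = 0}
  add_mem' {f g} hf hg k hk := by
    have h : fourierBasis.repr (f + g) k = fourierBasis.repr f k + fourierBasis.repr g k := by
      rw [map_add]; rfl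
    simpa only [fourierBasis_repr, hf k hk, hg k hk, add_zero] using h
  zero_mem' k _ := by
    have h : fourierBasis.repr (0 : L2) k = 0 := by
      rw [map_zero]; rfl
    simpa only [fourierBasis_repr] using h
  smul_mem' c f hf k hk := by
    have h : fourierBasis.repr (c • f) k = c • fourierBasis.repr f k := by
      rw [map_smul]; rfl
    simpa only [fourierBasis_repr, hf k hk, smul_zero] using h

theorem isClosed_H2 : IsClosed (H2 : Set L2) := by
  have h : (H2 : Set L2) = ⋂ (k : ℤ) (_ : k < 0),
      {f : L2 | inner ℂ (fourierLp (T := 2 * π) 2 k) f = 0} := by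
    ext f
    simp only [Set.mem_iInter, Set.mem_ofPred_eq, SetLike.mem_coe]
    refine forall₂_congr fun k _ => ?_
    rw [← fourierBasis_repr, HilbertBasis.repr_apply_apply, coe_fourierBasis]
  rw [h]
  exact isClosed_biInter fun k _ =>
    isClosed_eq (continuous_const.inner continuous_id) continuous_const

instance H2.hasOrthogonalProjection : H2.HasOrthogonalProjection :=
  have : CompleteSpace H2 := isClosed_H2.completeSpace_coe
  inferInstance

/-- The Riesz projection of `L²` onto `H²`, that is, the orthogonal projection. -/
def rieszP : L2 →L[ℂ] L2 := H2.starProjection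

/-- The complementary projection `Q = I - P`. -/
def rieszQ : L2 →L[ℂ] L2 := ContinuousLinearMap.id ℂ L2 - rieszP

/-- `f ↦ f̃`, `f̃(t) = f(1 / t)`, on `L²`. -/
def reflOp : L2 →L[ℂ] L2 :=
  (Lp.compMeasurePreservingₗᵢ ℂ (fun θ : Torus => -θ) measurePreserving_refl).toContinuousLinearMap

/-- The operator `(J f)(t) = t⁻¹ f(1 / t)` on `L²`. -/
def flipJ : L2 →L[ℂ] L2 := mulOp (ofContinuous (fourier (-1))) ∘L reflOp

/-- The Hilbert space `L²_N` of vector functions with `N` components in `L²`. -/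
abbrev L2N (N : ℕ) : Type := PiLp 2 fun _ : Fin N => L2

/-- The operator on `L²_N` given by an `N × N` matrix of operators on `L²`:
`(A f)_i = ∑_j A_{ij} f_j`. -/
def blockOp (A : Matrix (Fin N) (Fin N) (L2 →L[ℂ] L2)) : L2N N →L[ℂ] L2N N :=
  ((PiLp.continuousLinearEquiv 2 ℂ fun _ : Fin N => L2).symm : (Fin N → L2) →L[ℂ] L2N N) ∘L
    ContinuousLinearMap.pi fun i => ∑ j, A i j ∘L PiLp.proj 2 (fun _ : Fin N => L2) j

/-- An operator on `L²` acting elementwise on `L²_N`. -/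
def elementwise (N : ℕ) (A : L2 →L[ℂ] L2) : L2N N →L[ℂ] L2N N :=
  ((PiLp.continuousLinearEquiv 2 ℂ fun _ : Fin N => L2).symm : (Fin N → L2) →L[ℂ] L2N N) ∘L
    ContinuousLinearMap.pi fun i => A ∘L PiLp.proj 2 (fun _ : Fin N => L2) i

/-- Multiplication by a matrix symbol on `L²_N`. -/
def symbolOp (a : MatSymbol N) : L2N N →L[ℂ] L2N N := blockOp (a.map mulOp)

/-- The Hardy space `H²_N`. -/
def H2N (N : ℕ) : Submodule ℂ (L2N N) where
  carrier := {f | ∀ i, f i ∈ H2}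
  add_mem' := fun hf hg i => H2.add_mem (hf i) (hg i)
  zero_mem' := fun _ => H2.zero_mem
  smul_mem' := fun c _ hf i => H2.smul_mem c (hf i)

/-- `H²_N` is the image of the Riesz projection on `L²_N`. -/
theorem range_elementwise_rieszP (N : ℕ) :
    LinearMap.range (elementwise N rieszP : L2N N →ₗ[ℂ] L2N N) = H2N N := by
  apply le_antisymm
  · rintro _ ⟨f, rfl⟩ i
    exact H2.starProjection_apply_mem (f i)
  · intro f hf
    refine ⟨f, ?_⟩
    ext1 i
    exact Submodule.starProjection_eq_self_iff.2 (hf i)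

/-- The Hankel operator `H(a) = P a Q J` restricted to `Im P = H²_N`, as an operator on `H²_N`. -/
def hankel (a : MatSymbol N) : H2N N →L[ℂ] H2N N :=
  (elementwise N rieszP ∘L symbolOp a ∘L elementwise N rieszQ ∘L elementwise N flipJ ∘L
    (H2N N).subtypeL).codRestrict (H2N N) fun _ =>
      (range_elementwise_rieszP N).le ⟨_, rfl⟩

end HankelProduct

end
open HankelProduct

/-! Up to bounded outer factors a Hankel operator is the compression `P a Q`. If `φ` has no positive
frequencies then `P φ Q = 0`, and inserting `P + Q = I` gives `P φ b Q = (P φ)(P b Q)` and `P b φ Q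
= (P b Q)(φ Q)`. Anti-analytic factors can therefore be pulled out on either side. In (a) this
reduces the two Hankel factors to `P u₊ Q` and `P ũ₋⁻¹ Q`; in (b) it reduces them to `P ũ₋⁻¹ Q` and
`P u₊⁻¹ Q`. Each product thus contains one compression with symbol in the `ψ`-class and one with
symbol in the `ω`-class.

For a generalized Hölder symbol, Jackson's theorem gives trigonometric polynomials of degree at most
`2(m+1)` with uniform error `O(ω(1/(m+1)))`. The compression of a polynomial of degree `d` has rank
at most `d`, so `P a Q` is approximable at rank `O(m+1)` with error `O(ω(1/(m+1)))`: this is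
`FiniteRankApprox`.

Such rates multiply under composition, because `AB - (A - A')(B - B')` has rank at most `rank A' +
rank B'`. So the products have `s_n = O(ω(1/(m+1)) ψ(1/(m+1)))` at some `n = O(m+1)`, and since
`s_n` decreases, the assumed series controls `∑ s_n^p`. -/

noncomputable section

namespace HankelProduct

/-! ### Operators approximated by operators of finite rank at a prescribed rate -/

section FiniteRankApprox

universe u

variable {E F G : Type u} [NormedAddCommGroup E] [NormedSpace ℂ E] [NormedAddCommGroup F]
  [NormedSpace ℂ F] [NormedAddCommGroup G] [NormedSpace ℂ G]

/-- `A` can be approximated by operators of rank `O(m + 1)` up to an error `O(ρ m)`. -/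
def FiniteRankApprox (ρ : ℕ → ℝ) (A : E →L[ℂ] F) : Prop :=
  ∃ (C : ℝ) (M : ℕ), ∀ m : ℕ, ∃ B : E →L[ℂ] F,
    (B : E →ₗ[ℂ] F).rank ≤ ((M * (m + 1) : ℕ) : Cardinal) ∧ ‖A - B‖ ≤ C * ρ m

theorem FiniteRankApprox.zero (ρ : ℕ → ℝ) : FiniteRankApprox ρ (0 : E →L[ℂ] F) :=
  ⟨0, 0, fun m => ⟨0, by simp, by simp⟩⟩

theorem FiniteRankApprox.add {ρ : ℕ → ℝ} {A B : E →L[ℂ] F} (hA : FiniteRankApprox ρ A)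
    (hB : FiniteRankApprox ρ B) : FiniteRankApprox ρ (A + B) := by
  obtain ⟨C, M, hA⟩ := hA
  obtain ⟨D, K, hB⟩ := hB
  refine ⟨C + D, M + K, fun m => ?_⟩
  obtain ⟨A', hA', hA''⟩ := hA m
  obtain ⟨B', hB', hB''⟩ := hB m
  refine ⟨A' + B', ?_, ?_⟩
  · refine (LinearMap.rank_add_le (A' : E →ₗ[ℂ] F) (B' : E →ₗ[ℂ] F)).trans ?_
    rw [add_mul, Nat.cast_add]
    exact add_le_add hA' hB'
  · rw [add_sub_add_comm, add_mul]
    exact (norm_add_le _ _).trans (add_le_add hA'' hB'')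

theorem FiniteRankApprox.sum {ι : Type*} {ρ : ℕ → ℝ} (s : Finset ι) {A : ι → E →L[ℂ] F}
    (hA : ∀ i ∈ s, FiniteRankApprox ρ (A i)) : FiniteRankApprox ρ (∑ i ∈ s, A i) :=
  Finset.sum_induction A _ (fun _ _ => FiniteRankApprox.add) (FiniteRankApprox.zero ρ) hA

theorem FiniteRankApprox.comp_left {ρ : ℕ → ℝ} {A : E →L[ℂ] F} (hA : FiniteRankApprox ρ A)
    (L : F →L[ℂ] G) : FiniteRankApprox ρ (L ∘L A) := by
  obtain ⟨C, M, hA⟩ := hA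
  refine ⟨‖L‖ * C, M, fun m => ?_⟩
  obtain ⟨A', hA', hA''⟩ := hA m
  refine ⟨L ∘L A', (LinearMap.rank_comp_le_right (A' : E →ₗ[ℂ] F) (L : F →ₗ[ℂ] G)).trans hA', ?_⟩
  rw [← ContinuousLinearMap.comp_sub, mul_assoc]
  exact (ContinuousLinearMap.opNorm_comp_le _ _).trans
    (mul_le_mul_of_nonneg_left hA'' (norm_nonneg _))

theorem FiniteRankApprox.comp_right {ρ : ℕ → ℝ} {A : F →L[ℂ] G} (hA : FiniteRankApprox ρ A)
    (R : E →L[ℂ] F) : FiniteRankApprox ρ (A ∘L R) := by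
  obtain ⟨C, M, hA⟩ := hA
  refine ⟨C * ‖R‖, M, fun m => ?_⟩
  obtain ⟨A', hA', hA''⟩ := hA m
  refine ⟨A' ∘L R, (LinearMap.rank_comp_le_left (R : E →ₗ[ℂ] F) (A' : F →ₗ[ℂ] G)).trans hA', ?_⟩
  rw [← ContinuousLinearMap.sub_comp, mul_right_comm]
  exact (ContinuousLinearMap.opNorm_comp_le _ _).trans
    (mul_le_mul_of_nonneg_right hA'' (norm_nonneg _))

/-- Rates multiply: `(A - A')(B - B') = AB - (A'B + (A - A')B')`. -/
theorem FiniteRankApprox.comp {ρ σ : ℕ → ℝ} {A : F →L[ℂ] G} {B : E →L[ℂ] F}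
    (hA : FiniteRankApprox ρ A) (hB : FiniteRankApprox σ B) :
    FiniteRankApprox (fun m => ρ m * σ m) (A ∘L B) := by
  obtain ⟨C, M, hA⟩ := hA
  obtain ⟨D, K, hB⟩ := hB
  refine ⟨C * D, M + K, fun m => ?_⟩
  obtain ⟨A', hA', hA''⟩ := hA m
  obtain ⟨B', hB', hB''⟩ := hB m
  refine ⟨A' ∘L B + (A - A') ∘L B', ?_, ?_⟩
  · refine (LinearMap.rank_add_le ((A' ∘L B : E →L[ℂ] G) : E →ₗ[ℂ] G)
      (((A - A') ∘L B' : E →L[ℂ] G) : E →ₗ[ℂ] G)).trans ?_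
    rw [add_mul, Nat.cast_add]
    exact add_le_add
      ((LinearMap.rank_comp_le_left (B : E →ₗ[ℂ] F) (A' : F →ₗ[ℂ] G)).trans hA')
      ((LinearMap.rank_comp_le_right (B' : E →ₗ[ℂ] F) ((A - A' : F →L[ℂ] G) : F →ₗ[ℂ] G)).trans hB')
  · have h : A ∘L B - (A' ∘L B + (A - A') ∘L B') = (A - A') ∘L (B - B') := by
      ext x
      simp
      abel
    rw [h, mul_mul_mul_comm]
    exact (ContinuousLinearMap.opNorm_comp_le _ _).trans
      (mul_le_mul hA'' hB'' (norm_nonneg _) ((norm_nonneg _).trans hA''))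

end FiniteRankApprox

/-! ### From approximation rates to Schatten classes. -/

section Schatten

variable {H : Type*} [NormedAddCommGroup H] [InnerProductSpace ℂ H]

theorem approxNumber_nonneg (A : H →L[ℂ] H) (n : ℕ) : 0 ≤ approxNumber A n :=
  Real.sInf_nonneg (by rintro _ ⟨F, -, rfl⟩; exact norm_nonneg _)

theorem approxNumber_le {A F : H →L[ℂ] H} {n : ℕ}
    (hF : (F : H →ₗ[ℂ] H).rank ≤ (n : Cardinal)) : approxNumber A n ≤ ‖A - F‖ :=
  csInf_le ⟨0, by rintro _ ⟨F, -, rfl⟩; exact norm_nonneg _⟩ ⟨F, hF, rfl⟩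

theorem antitone_approxNumber (A : H →L[ℂ] H) : Antitone (approxNumber A) := by
  intro n m h
  refine le_csInf ⟨_, 0, by simp, rfl⟩ ?_
  rintro _ ⟨F, hF, rfl⟩
  exact approxNumber_le (hF.trans (by exact_mod_cast h))

theorem FiniteRankApprox.isSchatten {p : ℝ} (hp : 0 < p) {ρ : ℕ → ℝ} (hρ : ∀ m, 0 ≤ ρ m)
    (hsum : Summable fun m => ρ m ^ p) {A : H →L[ℂ] H} (hA : FiniteRankApprox ρ A) :
    IsSchatten p A := by
  obtain ⟨C, M, hA⟩ := hA
  have hanti : Antitone fun n => approxNumber A n ^ p := fun n m h =>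
    Real.rpow_le_rpow (approxNumber_nonneg A m) (antitone_approxNumber A h) hp.le
  -- A decreasing sequence is summable once it is summable along one residue class. Modulus `M + 1`
  -- is nonzero even if `M = 0`, and the indices `(M + 1) m + (M + 1)` dominate the allowed rank `M
  -- (m + 1)`.
  refine (summable_indicator_mod_iff (m := M + 1) hanti ((M + 1 : ℕ) : ZMod (M + 1))).1 ?_
  rw [summable_indicator_mod_iff_summable]
  refine (hsum.mul_left (|C| ^ p)).of_nonneg_of_le
    (fun m => Real.rpow_nonneg (approxNumber_nonneg A _) p) fun m => ?_
  rw [← Real.mul_rpow (abs_nonneg C) (hρ m)]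
  refine Real.rpow_le_rpow (approxNumber_nonneg A _) ?_ hp.le
  obtain ⟨F, hF, hF'⟩ := hA m
  refine (approxNumber_le (hF.trans ?_)).trans
    (hF'.trans (mul_le_mul_of_nonneg_right (le_abs_self C) (hρ m)))
  exact_mod_cast (by nlinarith : M * (m + 1) ≤ (M + 1) * m + (M + 1))

end Schatten

/-! ### Multiplication operators and Fourier coefficients -/

theorem coeFn_mulOp (φ : LInf) (g : L2) :
    (mulOp φ g : Torus → ℂ) =ᵐ[torusMeasure] fun t => φ.1 t * g t :=
  (ContinuousLinearMap.mul ℂ ℂ).coeFn_holder (toLpTop φ) g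

theorem coeFn_LInf_mul (φ ψ : LInf) :
    ((φ * ψ).1 : Torus → ℂ) =ᵐ[torusMeasure] fun t => φ.1 t * ψ.1 t :=
  AEEqFun.coeFn_mul φ.1 ψ.1

theorem mulOp_mul (φ ψ : LInf) : mulOp (φ * ψ) = mulOp φ ∘L mulOp ψ := by
  ext1 g
  apply Lp.ext
  filter_upwards [coeFn_mulOp (φ * ψ) g, coeFn_mulOp φ (mulOp ψ g), coeFn_mulOp ψ g,
    coeFn_LInf_mul φ ψ] with t h₁ h₂ h₃ h₄
  rw [ContinuousLinearMap.comp_apply, h₁, h₂, h₃, h₄, mul_assoc]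

/-- `mulOp` as an additive map. -/
def mulOpHom : LInf →+ (L2 →L[ℂ] L2) :=
  AddMonoidHom.mk' mulOp fun φ ψ =>
    ((ContinuousLinearMap.mul ℂ ℂ).holderL torusMeasure ∞ 2 2).map_add (toLpTop φ) (toLpTop ψ)

theorem mulOp_sub (φ ψ : LInf) : mulOp (φ - ψ) = mulOp φ - mulOp ψ :=
  mulOpHom.map_sub φ ψ

theorem mulOp_sum {ι : Type*} (s : Finset ι) (φ : ι → LInf) :
    mulOp (∑ i ∈ s, φ i) = ∑ i ∈ s, mulOp (φ i) :=
  map_sum mulOpHom φ s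

theorem norm_mulOp_le (φ : LInf) : ‖mulOp φ‖ ≤ ‖toLpTop φ‖ := by
  refine ContinuousLinearMap.opNorm_le_bound _ (norm_nonneg _) fun g => ?_
  refine ((ContinuousLinearMap.mul ℂ ℂ).norm_holder_apply_apply_le (r := 2)
    (toLpTop φ) g).trans ?_
  gcongr
  exact mul_le_of_le_one_left (norm_nonneg _) (ContinuousLinearMap.opNorm_mul_le ℂ ℂ)

theorem coeFn_ofContinuous (f : C(Torus, ℂ)) :
    ((ofContinuous f).1 : Torus → ℂ) =ᵐ[torusMeasure] f :=
  ContinuousMap.coeFn_toLp (p := ∞) (𝕜 := ℂ) torusMeasure f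

theorem ofContinuous_sub (f g : C(Torus, ℂ)) :
    ofContinuous (f - g) = ofContinuous f - ofContinuous g :=
  Subtype.ext (congrArg Subtype.val ((ContinuousMap.toLp ∞ torusMeasure ℂ).map_sub f g))

theorem norm_mulOp_ofContinuous_le (f : C(Torus, ℂ)) {C : ℝ} (hC : 0 ≤ C)
    (hf : ∀ x, ‖f x‖ ≤ C) : ‖mulOp (ofContinuous f)‖ ≤ C := by
  refine (norm_mulOp_le _).trans ?_
  refine (Lp.norm_le_of_ae_bound (f := toLpTop (ofContinuous f)) hC ?_).trans_eq (by simp)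
  filter_upwards [coeFn_ofContinuous f] with t ht
  exact (congrArg norm ht).trans_le (hf t)

theorem inner_fourierLp (g : L2) (k : ℤ) :
    inner ℂ (fourierLp (T := 2 * π) 2 k) g = fourierCoeff (g : Torus → ℂ) k := by
  rw [← fourierBasis_repr, HilbertBasis.repr_apply_apply, coe_fourierBasis]

theorem ext_fourierCoeff {f g : L2}
    (h : ∀ k, fourierCoeff (f : Torus → ℂ) k = fourierCoeff (g : Torus → ℂ) k) : f = g := by
  apply fourierBasis.repr.injective
  ext k
  rw [fourierBasis_repr, fourierBasis_repr, h]

theorem fourierCoeff_L2_sub (f g : L2) (k : ℤ) : fourierCoeff ((f - g : L2) : Torus → ℂ) k =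
    fourierCoeff (f : Torus → ℂ) k - fourierCoeff (g : Torus → ℂ) k := by
  simp only [← inner_fourierLp, inner_sub_right]

/-- The Fourier coefficients of a product are given by convolution. -/
theorem hasSum_fourierCoeff_mulOp (φ : LInf) (g : L2) (m : ℤ) :
    HasSum (fun k => fourierCoeff (φ.1 : Torus → ℂ) (m - k) * fourierCoeff (g : Torus → ℂ) k)
      (fourierCoeff (mulOp φ g : Torus → ℂ) m) := by
  have hφ : MemLp (φ.1 : Torus → ℂ) ∞ torusMeasure := Lp.mem_Lp_iff_memLp.1 φ.2
  -- The `m`-th coefficient of `φ h` is the inner product of `conj φ · e_m` with `h`, so the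
  -- convolution formula is Parseval's identity for this pairing.
  have hmem : MemLp (fun t : Torus => starRingEnd ℂ (φ.1 t) * fourier m t) 2 torusMeasure := by
    have h := (((hφ.star).mul
      ((Lp.memLp (fourierLp (T := 2 * π) ∞ m)).ae_eq (coeFn_fourierLp ∞ m)) :
        MemLp _ ∞ torusMeasure)).mono_exponent (q := ∞) (p := 2) le_top
    refine h.ae_eq (Filter.Eventually.of_forall fun t => ?_)
    simp [mul_comm]
  have hsum := fourierBasis.hasSum_inner_mul_inner (hmem.toLp _) g
  have key : ∀ h : L2, inner ℂ (hmem.toLp _) h = fourierCoeff (mulOp φ h : Torus → ℂ) m := by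
    intro h
    rw [L2.inner_def]
    refine integral_congr_ae ?_
    filter_upwards [hmem.coeFn_toLp, coeFn_mulOp φ h] with t h₁ h₂
    rw [h₁, h₂]
    simp [mul_comm, mul_left_comm]
    ring
  rw [key] at hsum
  convert! hsum using 2 with k
  rw [key, coe_fourierBasis, inner_fourierLp]
  congr 1
  refine integral_congr_ae ?_
  filter_upwards [coeFn_mulOp φ (fourierLp 2 k), coeFn_fourierLp (T := 2 * π) 2 k] with t h₁ h₂
  rw [h₁, h₂, smul_eq_mul, smul_eq_mul, neg_sub, sub_eq_neg_add, fourier_add]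
  ring

/-- In the convolution only `k < 0` contributes from `g`, and then `m - k > d`, where `φ` has no
coefficient. -/
theorem fourierCoeff_mulOp_eq_zero {φ : LInf} {g : L2} {m d : ℤ}
    (hφ : ∀ k, d < k → fourierCoeff (φ.1 : Torus → ℂ) k = 0)
    (hg : ∀ k, 0 ≤ k → fourierCoeff (g : Torus → ℂ) k = 0) (hm : d ≤ m) :
    fourierCoeff (mulOp φ g : Torus → ℂ) m = 0 := by
  refine (hasSum_fourierCoeff_mulOp φ g m).unique ?_
  convert! hasSum_zero with k
  rcases le_or_gt 0 k with hk | hk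
  · rw [hg k hk, mul_zero]
  · rw [hφ (m - k) (by omega), zero_mul]

/-! ### The Riesz projection in terms of Fourier coefficients -/

theorem fourierLp_mem_H2 {k : ℤ} (hk : 0 ≤ k) : (fourierLp (T := 2 * π) 2 k : L2) ∈ H2 := by
  intro j hj
  rw [← inner_fourierLp, orthonormal_iff_ite.1 orthonormal_fourier j k, if_neg (by omega)]

theorem fourierCoeff_rieszP_of_nonneg (f : L2) {k : ℤ} (hk : 0 ≤ k) :
    fourierCoeff (rieszP f : Torus → ℂ) k = fourierCoeff (f : Torus → ℂ) k := by
  rw [← inner_fourierLp, ← inner_fourierLp, rieszP,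
    ← Submodule.inner_starProjection_left_eq_right,
    Submodule.starProjection_eq_self_iff.2 (fourierLp_mem_H2 hk)]

theorem fourierCoeff_rieszP_of_neg (f : L2) {k : ℤ} (hk : k < 0) :
    fourierCoeff (rieszP f : Torus → ℂ) k = 0 :=
  (H2.starProjection_apply_mem f : rieszP f ∈ H2) k hk

theorem fourierCoeff_rieszQ_of_nonneg (f : L2) {k : ℤ} (hk : 0 ≤ k) :
    fourierCoeff (rieszQ f : Torus → ℂ) k = 0 := by
  have h : rieszQ f = f - rieszP f := rfl
  rw [h, fourierCoeff_L2_sub, fourierCoeff_rieszP_of_nonneg f hk, sub_self]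

theorem rieszP_add_rieszQ : rieszP + rieszQ = ContinuousLinearMap.id ℂ L2 := by
  rw [rieszQ, add_sub_cancel]

/-- `φ` has no Fourier coefficients of positive index. -/
def IsAntianalytic (φ : LInf) : Prop := ∀ k, 0 < k → fourierCoeff (φ.1 : Torus → ℂ) k = 0

theorem isAntianalytic_of_mem_HInfBar {φ : LInf} (hφ : φ ∈ HInfBar) : IsAntianalytic φ := by
  intro k hk
  rw [← map_eq_zero (starRingEnd ℂ), ← hφ (-k) (by omega), fourierCoeff, fourierCoeff,
    ← integral_conj]
  refine integral_congr_ae (Filter.Eventually.of_forall fun t => ?_)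
  simp

theorem coeFn_tilde (φ : LInf) :
    ((tilde φ).1 : Torus → ℂ) =ᵐ[torusMeasure] fun t => φ.1 (-t) :=
  Lp.coeFn_compMeasurePreserving (toLpTop φ) measurePreserving_refl

theorem isAntianalytic_tilde {φ : LInf} (hφ : φ ∈ HInf) : IsAntianalytic (tilde φ) := by
  intro k hk
  rw [fourierCoeff_congr_ae (coeFn_tilde φ), ← hφ (-k) (by omega), fourierCoeff, fourierCoeff,
    ← integral_neg_eq_self]
  refine integral_congr_ae (Filter.Eventually.of_forall fun t => ?_)
  simp [fourier_apply]

/-- An anti-analytic multiplier keeps negative frequencies negative, and `P` annihilates those. -/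
theorem rieszP_mulOp_rieszQ {φ : LInf} (hφ : IsAntianalytic φ) :
    rieszP ∘L mulOp φ ∘L rieszQ = 0 := by
  ext1 f
  refine ext_fourierCoeff fun k => ?_
  rw [zero_apply, ← inner_fourierLp 0, inner_zero_right]
  rcases lt_or_ge k 0 with hk | hk
  · exact fourierCoeff_rieszP_of_neg _ hk
  · exact (fourierCoeff_rieszP_of_nonneg _ hk).trans
      (fourierCoeff_mulOp_eq_zero hφ (fun j hj => fourierCoeff_rieszQ_of_nonneg f hj) hk)

/-- The product of `φ` with a function of negative frequencies has frequencies below `d`, of which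
`P` keeps only `0, …, d - 1`. Only an upper bound on the spectrum of `φ` matters. -/
theorem rank_rieszP_mulOp_rieszQ_le {φ : LInf} {d : ℕ}
    (hφ : ∀ k : ℤ, d < k → fourierCoeff (φ.1 : Torus → ℂ) k = 0) :
    ((rieszP ∘L mulOp φ ∘L rieszQ : L2 →L[ℂ] L2) : L2 →ₗ[ℂ] L2).rank ≤ (d : Cardinal) := by
  classical
  set s : Finset L2 := (Finset.range d).image fun k : ℕ => fourierLp (T := 2 * π) 2 (k : ℤ)
  refine (Submodule.rank_mono ?_).trans ((rank_span_finset_le (R := ℂ) s).trans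
    (by exact_mod_cast Finset.card_image_le.trans_eq (Finset.card_range d)))
  rintro _ ⟨f, rfl⟩
  set h : L2 := rieszP (mulOp φ (rieszQ f)) with hh
  change h ∈ _
  have hz : ∀ k : ℤ, (k < 0 ∨ d ≤ k) → fourierCoeff (h : Torus → ℂ) k = 0 := by
    rintro k (hk | hk)
    · exact fourierCoeff_rieszP_of_neg _ hk
    · exact (fourierCoeff_rieszP_of_nonneg _ (by omega)).trans
        (fourierCoeff_mulOp_eq_zero hφ (fun j hj => fourierCoeff_rieszQ_of_nonneg f hj) hk)
  have hsum := hasSum_fourier_series_L2 h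
  have hfin := hasSum_sum_of_ne_finset_zero (L := .unconditional ℤ)
    (f := fun k : ℤ => fourierCoeff (h : Torus → ℂ) k • fourierLp (T := 2 * π) 2 k)
    (s := Finset.Ico (0 : ℤ) d) fun k hk => by
      rw [hz k (by rw [Finset.mem_Ico] at hk; omega), zero_smul]
  rw [hsum.unique hfin]
  refine Submodule.sum_mem _ fun k hk => Submodule.smul_mem _ _ (Submodule.subset_span ?_)
  rw [Finset.mem_Ico] at hk
  refine Finset.mem_coe.2 (Finset.mem_image.2 ⟨k.toNat, Finset.mem_range.2 (by omega), ?_⟩)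
  rw [Int.toNat_of_nonneg hk.1]

/-! ### The modulus of continuity -/

theorem norm_sub_le_modulus (f : C(Torus, ℂ)) {h x : ℝ} (hx : |h| ≤ x) (y : ℝ) :
    ‖f ((y + h : ℝ) : Torus) - f (y : Torus)‖ ≤ modulus f x := by
  refine le_csSup ⟨‖f‖ + ‖f‖, ?_⟩ ⟨h, y, hx, rfl⟩
  rintro _ ⟨h, y, -, rfl⟩
  exact (norm_sub_le _ _).trans (add_le_add (f.norm_coe_le_norm _) (f.norm_coe_le_norm _))

theorem modulus_nonneg (f : Torus → ℂ) (x : ℝ) : 0 ≤ modulus f x :=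
  Real.sSup_nonneg (by rintro _ ⟨h, y, -, rfl⟩; exact norm_nonneg _)

theorem norm_sub_le_nat_mul_modulus (f : C(Torus, ℂ)) {h x : ℝ} (hx : |h| ≤ x) (y : ℝ) (k : ℕ) :
    ‖f ((y + k * h : ℝ) : Torus) - f (y : Torus)‖ ≤ k * modulus f x := by
  induction k with
  | zero => simp
  | succ k ih =>
    have e : y + ((k + 1 : ℕ) : ℝ) * h = y + k * h + h := by push_cast; ring
    rw [e, Nat.cast_succ, add_mul, one_mul, add_comm ((k : ℝ) * _)]
    exact (norm_sub_le_norm_sub_add_norm_sub _ (f ((y + k * h : ℝ) : Torus)) _).trans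
      (add_le_add (norm_sub_le_modulus f hx _) ih)

/-- The shift `h` is split into `⌈|h| / x⌉` equal steps, each of length at most `x`. -/
theorem norm_sub_le_one_add_mul_modulus (f : C(Torus, ℂ)) {x : ℝ} (hx : 0 < x) (y h : ℝ) :
    ‖f ((y + h : ℝ) : Torus) - f (y : Torus)‖ ≤ (1 + |h| / x) * modulus f x := by
  rcases eq_or_ne h 0 with rfl | hh
  · simpa using modulus_nonneg f x
  have hk : 0 < ⌈|h| / x⌉₊ := Nat.ceil_pos.2 (div_pos (abs_pos.2 hh) hx)
  have hk' : (0 : ℝ) < ⌈|h| / x⌉₊ := Nat.cast_pos.2 hk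
  have h1 := norm_sub_le_nat_mul_modulus f (h := h / ⌈|h| / x⌉₊) (x := x) (by
    rw [abs_div, Nat.abs_cast, div_le_iff₀ hk', ← div_le_iff₀' hx]
    exact Nat.le_ceil _) y ⌈|h| / x⌉₊
  rw [mul_div_cancel₀ _ hk'.ne'] at h1
  refine h1.trans (mul_le_mul_of_nonneg_right ?_ (modulus_nonneg f x))
  rw [add_comm]
  exact (Nat.ceil_lt_add_one (by positivity)).le

/-- The chord is `2 |sin (h / 2)|`; Jordan's inequality and `π ≤ 4` give `|sin (h / 2)| ≥ |h| / 4`.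
-/
theorem abs_le_two_mul_norm_one_sub_fourier {h : ℝ} (hh : |h| ≤ π) :
    |h| ≤ 2 * ‖1 - fourier 1 (h : Torus)‖ := by
  have e : fourier 1 (h : Torus) = Complex.exp (Complex.I * h) := by
    rw [fourier_coe_apply]
    congr 1
    push_cast
    field_simp
  rw [e, norm_sub_rev, Complex.norm_exp_I_mul_ofReal_sub_one]
  have h1 := Real.mul_abs_le_abs_sin (x := h / 2) (by rw [abs_div, abs_two]; linarith)
  rw [norm_mul, Real.norm_eq_abs, Real.norm_eq_abs, abs_two]
  rw [abs_div, abs_two] at h1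
  have h2 : |h| / 4 ≤ 2 / π * (|h| / 2) := by
    rw [div_mul_div_comm, div_le_div_iff₀ (by norm_num) (by positivity)]
    nlinarith [Real.pi_le_four, abs_nonneg h]
  linarith

/-- The growth `1 + n|h| ≤ 2 + (n h)² / 2` is written in terms of `|1 - t|²`, the factor that the
Dirichlet kernel can absorb. -/
theorem norm_sub_le_quadratic_mul_modulus (f : C(Torus, ℂ)) {n : ℕ} (hn : 0 < n) (x t : Torus) :
    ‖f x - f (x - t)‖ ≤ (2 + 2 * n ^ 2 * ‖1 - fourier 1 t‖ ^ 2) * modulus f (1 / n) := by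
  obtain ⟨y, rfl⟩ := QuotientAddGroup.mk_surjective x
  obtain ⟨h, hh, rfl⟩ : ∃ h : ℝ, |h| ≤ π ∧ (h : Torus) = t := by
    refine ⟨AddCircle.equivIoc (2 * π) (-π) t, ?_, AddCircle.coe_equivIoc⟩
    have := (AddCircle.equivIoc (2 * π) (-π) t).2
    rw [abs_le]
    constructor <;> linarith [this.1, this.2]
  have hn' : (0 : ℝ) < n := Nat.cast_pos.2 hn
  have h1 := norm_sub_le_one_add_mul_modulus f (x := 1 / n) (by positivity) y (-h)
  have e : ((y + -h : ℝ) : Torus) = (y : Torus) - (h : Torus) := by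
    rw [← sub_eq_add_neg, AddCircle.coe_sub]
  rw [e, abs_neg, norm_sub_rev] at h1
  refine h1.trans (mul_le_mul_of_nonneg_right ?_ (modulus_nonneg f _))
  have h2 := abs_le_two_mul_norm_one_sub_fourier hh
  have h3 : |h| ^ 2 ≤ 4 * ‖1 - fourier 1 (h : Torus)‖ ^ 2 := by
    nlinarith [abs_nonneg h]
  have h4 : |h| / (1 / n) = n * |h| := by field_simp
  rw [h4]
  nlinarith [sq_nonneg (n * |h| - 1), mul_le_mul_of_nonneg_left h3 (sq_nonneg (n : ℝ))]

/-! ### Jackson's theorem -/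

theorem integrable_continuousMap (f : C(Torus, ℂ)) : Integrable f torusMeasure :=
  f.continuous.integrable_of_hasCompactSupport (HasCompactSupport.of_compactSpace f)

theorem integral_fourier (k : ℤ) :
    ∫ t : Torus, fourier k t ∂torusMeasure = if k = 0 then 1 else 0 := by
  have h := congrFun (fourierCoeff_fourier (T := 2 * π) k) 0
  simp only [fourierCoeff, neg_zero, fourier_zero, one_smul] at h
  rw [h, Pi.single_apply]
  simp only [eq_comm]

/-- The integers `0, …, n - 1`. -/
def freqs (n : ℕ) : Finset ℤ := (Finset.range n).map Nat.castEmbedding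

/-- The (one-sided) Dirichlet kernel `∑_{k < n} t ^ k`. -/
def dirichlet (n : ℕ) (t : Torus) : ℂ := ∑ k ∈ freqs n, fourier k t

@[fun_prop]
theorem continuous_dirichlet (n : ℕ) : Continuous (dirichlet n) := by
  unfold dirichlet
  fun_prop

theorem one_sub_mul_dirichlet (n : ℕ) (t : Torus) :
    (1 - fourier 1 t) * dirichlet n t = 1 - fourier n t := by
  have h : ∀ k : ℕ, fourier (k : ℤ) t = fourier 1 t ^ k := by
    intro k
    induction k with
    | zero => simp
    | succ k ih => rw [Nat.cast_succ, fourier_add, ih, pow_succ]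
  rw [dirichlet, freqs, Finset.sum_map]
  simp only [Nat.castEmbedding_apply, h]
  exact mul_neg_geom_sum _ _

theorem sq_norm_dirichlet (n : ℕ) (t : Torus) :
    ((‖dirichlet n t‖ ^ 2 : ℝ) : ℂ) = ∑ q ∈ freqs n ×ˢ freqs n, fourier (q.1 - q.2) t := by
  rw [Complex.ofReal_pow, ← Complex.mul_conj', dirichlet, map_sum, Finset.sum_mul_sum,
    Finset.sum_product]
  simp only [sub_eq_add_neg, fourier_add, fourier_neg]

/-- The quadruples of frequencies occurring in `|D_n|⁴`. -/
def quads (n : ℕ) : Finset ((ℤ × ℤ) × ℤ × ℤ) := (freqs n ×ˢ freqs n) ×ˢ freqs n ×ˢ freqs n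

/-- The frequency belonging to a quadruple. -/
def quadFreq (q : (ℤ × ℤ) × ℤ × ℤ) : ℤ := q.1.1 - q.1.2 + (q.2.1 - q.2.2)

theorem norm_dirichlet_pow_four (n : ℕ) (t : Torus) :
    ((‖dirichlet n t‖ ^ 4 : ℝ) : ℂ) = ∑ q ∈ quads n, fourier (quadFreq q) t := by
  rw [show 4 = 2 * 2 from rfl, pow_mul, pow_two (_ ^ 2), Complex.ofReal_mul, sq_norm_dirichlet,
    Finset.sum_mul_sum, quads, Finset.sum_product (s := freqs n ×ˢ freqs n)]
  simp only [quadFreq, fourier_add]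

theorem integral_sq_norm_dirichlet (n : ℕ) :
    ∫ t : Torus, ‖dirichlet n t‖ ^ 2 ∂torusMeasure = n := by
  apply Complex.ofReal_injective
  rw [← integral_complex_ofReal]
  simp only [sq_norm_dirichlet]
  rw [integral_finsetSum _ fun q _ => integrable_continuousMap _]
  simp only [integral_fourier, sub_eq_zero]
  rw [Finset.sum_product]
  simp only [Finset.sum_ite_eq, Finset.sum_ite_mem, Finset.inter_self, Finset.sum_const]
  simp [freqs]

/-- By orthogonality the integral counts the quadruples with `a - b + c - d = 0`, that is `a + c = b
+ d`. -/
theorem integral_norm_dirichlet_pow_four (n : ℕ) :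
    ∫ t : Torus, ‖dirichlet n t‖ ^ 4 ∂torusMeasure = (freqs n).addEnergy (freqs n) := by
  apply Complex.ofReal_injective
  rw [← integral_complex_ofReal]
  simp only [norm_dirichlet_pow_four]
  rw [integral_finsetSum _ fun q _ => integrable_continuousMap _]
  simp only [integral_fourier]
  rw [Finset.sum_boole, Finset.addEnergy, quads]
  simp only [Complex.ofReal_natCast, Nat.cast_inj]
  congr 1
  refine Finset.filter_congr fun q _ => ?_
  rw [quadFreq]
  omega

-- Cauchy–Schwarz bounds `n⁴` by the size of the sumset times the energy, and the sumset lies in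
-- `[0, 2n)`. This replaces an exact evaluation of the kernel's mass.
open scoped Pointwise in
theorem cube_le_two_mul_addEnergy {n : ℕ} (hn : 0 < n) :
    (n : ℝ) ^ 3 ≤ 2 * (freqs n).addEnergy (freqs n) := by
  have h1 := Finset.le_card_add_mul_addEnergy (freqs n) (freqs n)
  have h2 : (freqs n + freqs n).card ≤ 2 * n := by
    have : freqs n + freqs n ⊆ Finset.Ico (0 : ℤ) (2 * n) := by
      intro k hk
      obtain ⟨i, hi, j, hj, rfl⟩ := Finset.mem_add.1 hk
      simp only [freqs, Finset.mem_map, Finset.mem_range, Nat.castEmbedding_apply] at hi hj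
      obtain ⟨i, hi, rfl⟩ := hi
      obtain ⟨j, hj, rfl⟩ := hj
      rw [Finset.mem_Ico]
      omega
    refine (Finset.card_le_card this).trans ?_
    rw [Int.card_Ico]
    omega
  have h3 : (freqs n).card = n := by simp [freqs]
  rw [h3] at h1
  have h4 := h1.trans (Nat.mul_le_mul_right _ h2)
  have h5 : n ^ 3 ≤ 2 * (freqs n).addEnergy (freqs n) :=
    Nat.le_of_mul_le_mul_left (by linarith [h4] :
      n * n ^ 3 ≤ n * (2 * (freqs n).addEnergy (freqs n))) hn
  exact_mod_cast h5

/-- The mean of `f` with respect to the Jackson kernel `|D_n|⁴ / ‖D_n‖₄⁴`. -/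
def jacksonMean (n : ℕ) (f : C(Torus, ℂ)) : C(Torus, ℂ) :=
  ((freqs n).addEnergy (freqs n) : ℂ)⁻¹ •
    ∑ q ∈ quads n, fourierCoeff f (quadFreq q) • fourier (quadFreq q)

/-- A quadruple frequency is at most `2(n - 1)`. -/
theorem fourierCoeff_jacksonMean (n : ℕ) (f : C(Torus, ℂ)) {k : ℤ} (hk : (2 * n : ℕ) < k) :
    fourierCoeff (jacksonMean n f) k = 0 := by
  have h : fourierCoeff (∑ q ∈ quads n, ⇑(fourierCoeff f (quadFreq q) •
      (fourier (quadFreq q) : C(Torus, ℂ)))) k = 0 := by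
    rw [fourierCoeff.sum _ _ fun q _ => integrable_continuousMap _, Finset.sum_apply]
    refine Finset.sum_eq_zero fun q hq => ?_
    rw [ContinuousMap.coe_smul]
    have e := fourierCoeff.const_smul (T := 2 * π) (fourier (quadFreq q))
      (fourierCoeff f (quadFreq q)) k
    refine e.trans ?_
    rw [fourierCoeff_fourier, Pi.single_eq_of_ne, smul_zero]
    simp only [quads, freqs, Finset.mem_product, Finset.mem_map, Finset.mem_range,
      Nat.castEmbedding_apply] at hq
    obtain ⟨⟨⟨a, ha, ha'⟩, b, hb, hb'⟩, ⟨c, hc, hc'⟩, d, hd, hd'⟩ := hq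
    rw [quadFreq]
    omega
  rw [jacksonMean, ContinuousMap.coe_smul, ContinuousMap.coe_sum]
  refine (fourierCoeff.const_smul (T := 2 * π) _ _ k).trans ?_
  rw [h, smul_zero]

/-- The definition as a sum shows the degree; this convolution form is the one that yields the error
estimate. -/
theorem jacksonMean_apply (n : ℕ) (f : C(Torus, ℂ)) (x : Torus) :
    jacksonMean n f x = ((freqs n).addEnergy (freqs n) : ℂ)⁻¹ *
      ∫ t : Torus, ((‖dirichlet n t‖ ^ 4 : ℝ) : ℂ) * f (x - t) ∂torusMeasure := by
  have h : ∫ t : Torus, ((‖dirichlet n t‖ ^ 4 : ℝ) : ℂ) * f (x - t) ∂torusMeasure =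
      ∫ t : Torus, ((‖dirichlet n (x - t)‖ ^ 4 : ℝ) : ℂ) * f t ∂torusMeasure := by
    rw [← integral_sub_left_eq_self _ torusMeasure x]
    simp only [sub_sub_cancel]
  rw [h, jacksonMean, ContinuousMap.smul_apply, smul_eq_mul, ContinuousMap.sum_apply]
  simp only [norm_dirichlet_pow_four, Finset.sum_mul]
  rw [integral_finsetSum]
  · congr 1
    refine Finset.sum_congr rfl fun q _ => ?_
    rw [ContinuousMap.smul_apply, fourierCoeff, smul_eq_mul, ← integral_mul_const]
    refine integral_congr_ae (Filter.Eventually.of_forall fun t => ?_)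
    simp only [sub_eq_add_neg, fourier_apply, smul_add, smul_neg, neg_smul, toCircle_add,
      Circle.coe_mul, smul_eq_mul]
    ring
  · intro q _
    exact integrable_continuousMap
      ⟨fun t => fourier (quadFreq q) (x - t) * f t, by fun_prop⟩

/-- The normalized kernel has mass one, so the error is an average of `f x - f (x - t)`. With `E`
the energy, it is at most `(2 E + 8 n² · n) δ / E`, and `n³ ≤ 2 E` gives `2 + 16 = 18`. -/
theorem norm_sub_jacksonMean_le (f : C(Torus, ℂ)) {n : ℕ} (hn : 0 < n) (x : Torus) :
    ‖f x - jacksonMean n f x‖ ≤ 18 * modulus f (1 / n) := by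
  set E : ℝ := (((freqs n).addEnergy (freqs n) : ℕ) : ℝ) with hE
  set δ := modulus f (1 / n)
  have hδ : 0 ≤ δ := modulus_nonneg f _
  have hn' : (0 : ℝ) < n := Nat.cast_pos.2 hn
  have hEn : (n : ℝ) ^ 3 ≤ 2 * E := cube_le_two_mul_addEnergy hn
  have hE0 : 0 < E := by nlinarith [pow_pos hn' 3]
  have hint : ∀ g : Torus → ℝ, Continuous g → Integrable g torusMeasure := fun g hg =>
    hg.integrable_of_hasCompactSupport (HasCompactSupport.of_compactSpace g)
  have hint' : ∀ g : Torus → ℂ, Continuous g → Integrable g torusMeasure := fun g hg =>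
    hg.integrable_of_hasCompactSupport (HasCompactSupport.of_compactSpace g)
  have e : f x - jacksonMean n f x = (E : ℂ)⁻¹ *
      ∫ t : Torus, ((‖dirichlet n t‖ ^ 4 : ℝ) : ℂ) * (f x - f (x - t)) ∂torusMeasure := by
    simp only [mul_sub]
    rw [integral_sub (hint' _ (by fun_prop)) (hint' _ (by fun_prop)), integral_mul_const,
      integral_complex_ofReal, integral_norm_dirichlet_pow_four, jacksonMean_apply, mul_sub,
      ← mul_assoc, ← hE, inv_mul_cancel₀ (Complex.ofReal_ne_zero.2 hE0.ne'), one_mul]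
    simp [hE]
  have hbound : ‖∫ t : Torus, ((‖dirichlet n t‖ ^ 4 : ℝ) : ℂ) * (f x - f (x - t)) ∂torusMeasure‖ ≤
      ∫ t : Torus, (2 * δ) * ‖dirichlet n t‖ ^ 4 + (8 * n ^ 2 * δ) * ‖dirichlet n t‖ ^ 2
        ∂torusMeasure := by
    refine norm_integral_le_of_norm_le (hint _ (by fun_prop))
      (Filter.Eventually.of_forall fun t => ?_)
    rw [norm_mul, Complex.norm_real, Real.norm_of_nonneg (by positivity)]
    refine (mul_le_mul_of_nonneg_left (norm_sub_le_quadratic_mul_modulus f hn x t)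
      (by positivity)).trans ?_
    -- Here `(1 - t) D_n = 1 - t^n` trades the quadratic growth for two powers of `|D_n|`, leaving
    -- the explicit second moment.
    have h1 : ‖1 - fourier 1 t‖ ^ 2 * ‖dirichlet n t‖ ^ 2 ≤ 4 := by
      rw [← mul_pow, ← norm_mul, one_sub_mul_dirichlet]
      have : ‖1 - fourier n t‖ ≤ 2 := by
        refine (norm_sub_le _ _).trans ?_
        rw [norm_one, fourier_apply, Circle.norm_coe]
        norm_num
      nlinarith [norm_nonneg (1 - fourier n t)]
    have h2 : 0 ≤ 2 * n ^ 2 * δ * ‖dirichlet n t‖ ^ 2 := by positivity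
    nlinarith [mul_le_mul_of_nonneg_left h1 h2]
  rw [integral_add (hint _ (by fun_prop)) (hint _ (by fun_prop)), integral_const_mul,
    integral_const_mul, integral_norm_dirichlet_pow_four, integral_sq_norm_dirichlet,
    ← hE] at hbound
  rw [e, norm_mul, norm_inv, Complex.norm_real, Real.norm_of_nonneg hE0.le,
    inv_mul_le_iff₀ hE0]
  refine hbound.trans ?_
  nlinarith [mul_le_mul_of_nonneg_right hEn hδ]

/-! ### Generalized Hölder symbols -/

theorem one_div_natCast_succ_mem_Ioc (m : ℕ) : 1 / ((m : ℝ) + 1) ∈ Set.Ioc 0 π := by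
  refine ⟨by positivity, le_trans ?_ Real.two_le_pi⟩
  rw [div_le_iff₀ (by positivity)]
  linarith [Nat.cast_nonneg (α := ℝ) m]

theorem finiteRankApprox_of_mem_genHolder {ω : ℝ → ℝ} (hω : ∀ x ∈ Set.Ioc (0 : ℝ) π, 0 < ω x)
    {φ : LInf} (hφ : φ ∈ GenHolder ω) :
    FiniteRankApprox (fun m => ω (1 / ((m : ℝ) + 1))) (rieszP ∘L mulOp φ ∘L rieszQ) := by
  obtain ⟨f, ⟨C, hC⟩, rfl⟩ := hφ
  -- The `18` is Jackson's constant, `C` the Hölder constant of `f`; the `2` comes from the degree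
  -- bound `2(m + 1)`.
  refine ⟨‖rieszP‖ * (18 * C * ‖rieszQ‖), 2, fun m => ?_⟩
  have hm := one_div_natCast_succ_mem_Ioc m
  refine ⟨rieszP ∘L mulOp (ofContinuous (jacksonMean (m + 1) f)) ∘L rieszQ,
    rank_rieszP_mulOp_rieszQ_le fun k hk => ?_, ?_⟩
  · rw [fourierCoeff_congr_ae (coeFn_ofContinuous _)]
    exact fourierCoeff_jacksonMean _ f hk
  · rw [← ContinuousLinearMap.comp_sub, ← ContinuousLinearMap.sub_comp, ← mulOp_sub,
      ← ofContinuous_sub]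
    have h1 : modulus f (1 / ((m : ℝ) + 1)) ≤ C * ω (1 / ((m : ℝ) + 1)) := by
      rw [← div_le_iff₀ (hω _ hm)]
      exact hC ⟨_, hm, rfl⟩
    have h2 : ∀ x, ‖(f - jacksonMean (m + 1) f) x‖ ≤ 18 * (C * ω (1 / ((m : ℝ) + 1))) := by
      intro x
      refine (norm_sub_jacksonMean_le f m.succ_pos x).trans ?_
      push_cast
      linarith
    have h3 := norm_mulOp_ofContinuous_le _ ((norm_nonneg _).trans (h2 0)) h2
    calc _ ≤ ‖rieszP‖ * (18 * (C * ω (1 / ((m : ℝ) + 1))) * ‖rieszQ‖) := by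
          refine (ContinuousLinearMap.opNorm_comp_le _ _).trans ?_
          gcongr
          refine (ContinuousLinearMap.opNorm_comp_le _ _).trans ?_
          gcongr
      _ = _ := by ring

theorem modulus_comp_neg (f : C(Torus, ℂ)) (x : ℝ) :
    modulus (fun t => f (-t)) x = modulus f x := by
  unfold modulus
  congr 1
  ext r
  constructor
  all_goals
    rintro ⟨h, y, hh, rfl⟩
    refine ⟨-h, -y, by rwa [abs_neg], ?_⟩
    simp [add_comm]

theorem tilde_mem_genHolder {ω : ℝ → ℝ} {φ : LInf} (hφ : φ ∈ GenHolder ω) :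
    tilde φ ∈ GenHolder ω := by
  obtain ⟨f, hf, rfl⟩ := hφ
  refine ⟨f.comp ⟨fun t => -t, continuous_neg⟩, ?_, ?_⟩
  · unfold IsGenHolder at hf ⊢
    simp only [← modulus_comp_neg f] at hf
    exact hf
  · refine Subtype.ext (AEEqFun.ext ?_)
    refine (coeFn_tilde _).trans (Filter.EventuallyEq.trans ?_ (coeFn_ofContinuous _).symm)
    exact measurePreserving_refl.quasiMeasurePreserving.ae_eq_comp (coeFn_ofContinuous f)

/-! ### Matrix symbols -/

theorem tilde_mul (φ ψ : LInf) : tilde (φ * ψ) = tilde φ * tilde ψ := by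
  refine Subtype.ext (AEEqFun.ext ?_)
  have h := measurePreserving_refl.quasiMeasurePreserving.ae_eq_comp (coeFn_LInf_mul φ ψ)
  filter_upwards [coeFn_tilde (φ * ψ), coeFn_LInf_mul (tilde φ) (tilde ψ), coeFn_tilde φ,
    coeFn_tilde ψ, h] with t h₁ h₂ h₃ h₄ h₅
  rw [h₁, h₂, h₃, h₄]
  exact h₅

theorem tilde_one : tilde 1 = 1 := by
  refine Subtype.ext (AEEqFun.ext ?_)
  have h : ((1 : LInf).1 : Torus → ℂ) =ᵐ[torusMeasure] 1 := AEEqFun.coeFn_one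
  exact (coeFn_tilde 1).trans
    ((measurePreserving_refl.quasiMeasurePreserving.ae_eq_comp h).trans h.symm)

theorem tilde_add (φ ψ : LInf) : tilde (φ + ψ) = tilde φ + tilde ψ :=
  Subtype.ext (congrArg Subtype.val
    ((Lp.compMeasurePreserving (fun θ : Torus => -θ) measurePreserving_refl).map_add
      (toLpTop φ) (toLpTop ψ)))

/-- `tilde` as a ring homomorphism. -/
def tildeHom : LInf →+* LInf :=
  RingHom.mk' ⟨⟨tilde, tilde_one⟩, tilde_mul⟩ tilde_add

variable {N : ℕ}

theorem symbolTilde_mul (a b : MatSymbol N) :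
    symbolTilde (a * b) = symbolTilde a * symbolTilde b :=
  Matrix.map_mul (f := tildeHom)

theorem symbolTilde_one : symbolTilde (1 : MatSymbol N) = 1 :=
  map_one (tildeHom.mapMatrix (m := Fin N))

@[simp]
theorem elementwise_apply (A : L2 →L[ℂ] L2) (f : L2N N) (i : Fin N) :
    elementwise N A f i = A (f i) := rfl

@[simp]
theorem blockOp_apply (A : Matrix (Fin N) (Fin N) (L2 →L[ℂ] L2)) (f : L2N N) (i : Fin N) :
    blockOp A f i = ∑ j, A i j (f j) := by
  simp [blockOp]

theorem symbolOp_mul (a b : MatSymbol N) : symbolOp (a * b) = symbolOp a ∘L symbolOp b := by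
  ext1 f
  ext1 i
  simp only [symbolOp, ContinuousLinearMap.comp_apply, blockOp_apply, Matrix.map_apply,
    Matrix.mul_apply, mulOp_sum, mulOp_mul, sum_apply, map_sum]
  rw [Finset.sum_comm]

/-- The operator `P a Q` on `L²_N`. -/
def compressOp (a : MatSymbol N) : L2N N →L[ℂ] L2N N :=
  elementwise N rieszP ∘L symbolOp a ∘L elementwise N rieszQ

theorem compressOp_eq_blockOp (a : MatSymbol N) :
    compressOp a = blockOp (a.map fun φ => rieszP ∘L mulOp φ ∘L rieszQ) := by
  ext1 f
  ext1 i
  simp [compressOp, symbolOp]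

/-- The inclusion of `L²` into `L²_N` as the `i`-th component. -/
def inclusion (i : Fin N) : L2 →L[ℂ] L2N N :=
  ((PiLp.continuousLinearEquiv 2 ℂ fun _ : Fin N => L2).symm : (Fin N → L2) →L[ℂ] L2N N) ∘L
    ContinuousLinearMap.single ℂ (fun _ : Fin N => L2) i

theorem inclusion_apply (i k : Fin N) (f : L2) : inclusion i f k = if k = i then f else 0 :=
  Pi.single_apply i f k

/-- Reduces approximation of a matrix compression to its scalar entries, since rates survive finite
sums and bounded factors. -/
theorem blockOp_eq_sum (A : Matrix (Fin N) (Fin N) (L2 →L[ℂ] L2)) :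
    blockOp A = ∑ i, ∑ j, inclusion i ∘L A i j ∘L PiLp.proj 2 (fun _ : Fin N => L2) j := by
  ext1 f
  ext1 k
  simp only [blockOp_apply, sum_apply, WithLp.ofLp_sum, Finset.sum_apply,
    ContinuousLinearMap.comp_apply, inclusion_apply, PiLp.proj_apply]
  rw [Finset.sum_comm]
  simp

theorem compressOp_eq_zero {a : MatSymbol N} (ha : ∀ i j, IsAntianalytic (a i j)) :
    compressOp a = 0 := by
  rw [compressOp_eq_blockOp]
  ext1 f
  ext1 i
  simp [rieszP_mulOp_rieszQ (ha i _)]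

theorem finiteRankApprox_compressOp {ω : ℝ → ℝ} (hω : ∀ x ∈ Set.Ioc (0 : ℝ) π, 0 < ω x)
    {a : MatSymbol N} (ha : ∀ i j, a i j ∈ GenHolder ω) :
    FiniteRankApprox (fun m => ω (1 / ((m : ℝ) + 1))) (compressOp a) := by
  rw [compressOp_eq_blockOp, blockOp_eq_sum]
  refine .sum _ fun i _ => .sum _ fun j _ => ?_
  exact ((finiteRankApprox_of_mem_genHolder hω (ha i j)).comp_right _).comp_left _

theorem elementwise_rieszP_add_rieszQ (N : ℕ) :
    elementwise N rieszP + elementwise N rieszQ = ContinuousLinearMap.id ℂ (L2N N) := by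
  ext1 f
  ext1 i
  exact congrArg (· (f i)) rieszP_add_rieszQ

/-- `P a b Q = (P a) (P b Q)` if `a` is anti-analytic. -/
theorem compressOp_mul_of_left {a : MatSymbol N} (ha : ∀ i j, IsAntianalytic (a i j))
    (b : MatSymbol N) :
    compressOp (a * b) = (elementwise N rieszP ∘L symbolOp a) ∘L compressOp b := by
  -- The identity `P + Q` is inserted between `a` and `b`; the `Q` term carries the factor `P a Q =
  -- 0`.
  have h : compressOp (a * b) = (elementwise N rieszP ∘L symbolOp a) ∘L compressOp b +
      compressOp a ∘L symbolOp b ∘L elementwise N rieszQ := by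
    ext1 f
    have := congrArg (· (symbolOp b (elementwise N rieszQ f))) (elementwise_rieszP_add_rieszQ N)
    simp only [add_apply, ContinuousLinearMap.id_apply] at this
    simp only [compressOp, symbolOp_mul, ContinuousLinearMap.comp_apply,
      add_apply, ← map_add, this]
  rw [h, compressOp_eq_zero ha, ContinuousLinearMap.zero_comp, add_zero]

/-- `P a b Q = (P a Q) (b Q)` if `b` is anti-analytic. -/
theorem compressOp_mul_of_right (a : MatSymbol N) {b : MatSymbol N}
    (hb : ∀ i j, IsAntianalytic (b i j)) :
    compressOp (a * b) = compressOp a ∘L symbolOp b ∘L elementwise N rieszQ := by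
  have h : compressOp (a * b) = compressOp a ∘L symbolOp b ∘L elementwise N rieszQ +
      elementwise N rieszP ∘L symbolOp a ∘L compressOp b := by
    ext1 f
    have := congrArg (· (symbolOp b (elementwise N rieszQ f))) (elementwise_rieszP_add_rieszQ N)
    simp only [add_apply, ContinuousLinearMap.id_apply] at this
    rw [add_comm] at this
    simp only [compressOp, symbolOp_mul, ContinuousLinearMap.comp_apply,
      add_apply, ← map_add, this]
  rw [h, compressOp_eq_zero hb, ContinuousLinearMap.comp_zero, ContinuousLinearMap.comp_zero,
    add_zero]

/-- The projection of `L²_N` onto `H²_N`, with codomain `H²_N`. -/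
def toH2N (N : ℕ) : L2N N →L[ℂ] H2N N :=
  (elementwise N rieszP).codRestrict (H2N N) fun _ => (range_elementwise_rieszP N).le ⟨_, rfl⟩

theorem toH2N_comp_rieszP (N : ℕ) : toH2N N ∘L elementwise N rieszP = toH2N N := by
  ext1 f
  refine Subtype.ext ?_
  ext1 i
  exact Submodule.starProjection_eq_self_iff.2 (H2.starProjection_apply_mem (f i))

/-- Since `P² = P`, the Hankel operator is `P a Q` between bounded operators, so approximation rates
for compressions pass to it. -/
theorem hankel_eq (a : MatSymbol N) :
    hankel a = toH2N N ∘L compressOp a ∘L elementwise N flipJ ∘L (H2N N).subtypeL := by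
  rw [compressOp, ContinuousLinearMap.comp_assoc, ← ContinuousLinearMap.comp_assoc (toH2N N),
    toH2N_comp_rieszP]
  rfl

end HankelProduct

end

/-! ### Factorization of the Hankel products. -/

theorem lemma4p3 (N : ℕ) (p : ℝ) (hp : 1 ≤ p) (ω ψ : ℝ → ℝ)
    (hω : BariStechkin ω) (hψ : BariStechkin ψ)
    (hsum : Summable fun k : ℕ => (ω (1 / ((k : ℝ) + 1)) * ψ (1 / ((k : ℝ) + 1))) ^ p)
    (um up : MatSymbol N)
    (hum : InvertibleIn (GenHolder ω ∩ HInfBar) um)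
    (hup : InvertibleIn (GenHolder ψ ∩ HInf) up) :
    (∀ a : MatSymbol N, a = um * up →
      IsSchatten p (hankel a ∘L hankel (symbolTilde a)⁻¹)) ∧
    (∀ vm vp : MatSymbol N, EntriesIn HInfBar vm → EntriesIn HInf vp →
      ∀ b c : MatSymbol N, b = vm * up⁻¹ → c = um⁻¹ * vp →
        IsSchatten p (hankel (symbolTilde c) ∘L hankel b) ∧
        IsSchatten p (hankel b ∘L hankel (symbolTilde c))) := by
  obtain ⟨hum, wm, hwm, humw, hwum⟩ := hum
  obtain ⟨hup, wp, hwp, hupw, hwup⟩ := hup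
  have hω0 := fun m => (hω.pos _ (one_div_natCast_succ_mem_Ioc m)).le
  have hψ0 := fun m => (hψ.pos _ (one_div_natCast_succ_mem_Ioc m)).le
  have hup_approx := finiteRankApprox_compressOp hψ.pos fun i j => (hup i j).1
  have hwp_approx := finiteRankApprox_compressOp hψ.pos fun i j => (hwp i j).1
  have hwm_approx := finiteRankApprox_compressOp hω.pos (a := symbolTilde wm)
    fun i j => tilde_mem_genHolder (hwm i j).1
  have hωψ := fun m => mul_nonneg (hω0 m) (hψ0 m)
  have hψω := fun m => mul_nonneg (hψ0 m) (hω0 m)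
  have hsum' : Summable fun k : ℕ =>
      (ψ (1 / ((k : ℝ) + 1)) * ω (1 / ((k : ℝ) + 1))) ^ p := by
    simpa only [mul_comm] using hsum
  have hp0 : 0 < p := by linarith
  refine ⟨?_, ?_⟩
  · rintro _ rfl
    -- Inversion reverses the order, placing the inverse of `ũ₊` on the left; being anti-analytic,
    -- it can be pulled out there.
    have hinv : (symbolTilde (um * up))⁻¹ = symbolTilde wp * symbolTilde wm := by
      refine Matrix.inv_eq_right_inv ?_
      rw [← symbolTilde_mul, ← symbolTilde_mul, mul_assoc, ← mul_assoc up, hupw, one_mul, humw,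
        symbolTilde_one]
    rw [hinv, hankel_eq, hankel_eq,
      compressOp_mul_of_left fun i j => isAntianalytic_of_mem_HInfBar (hum i j).2,
      compressOp_mul_of_left (a := symbolTilde wp) fun i j => isAntianalytic_tilde (hwp i j).2]
    exact FiniteRankApprox.isSchatten hp0 hψω hsum'
      ((((hup_approx.comp_left _).comp_right _).comp_left _).comp
        (((hwm_approx.comp_left _).comp_right _).comp_left _))
  · rintro vm vp hvm hvp _ _ rfl rfl
    -- In `b` the anti-analytic factor `v₋` leaves on the left; in `c̃` the factor `ṽ₊` is
    -- anti-analytic and leaves on the right.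
    rw [Matrix.inv_eq_right_inv hupw, Matrix.inv_eq_right_inv humw, symbolTilde_mul, hankel_eq,
      hankel_eq, compressOp_mul_of_left fun i j => isAntianalytic_of_mem_HInfBar (hvm i j),
      compressOp_mul_of_right (symbolTilde wm) (b := symbolTilde vp) fun i j => isAntianalytic_tilde (hvp i j)]
    have h1 := ((hwm_approx.comp_right
      (symbolOp (symbolTilde vp) ∘L elementwise N rieszQ)).comp_right
      (elementwise N flipJ ∘L (H2N N).subtypeL)).comp_left (toH2N N)
    have h2 := ((hwp_approx.comp_left (elementwise N rieszP ∘L symbolOp vm)).comp_right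
      (elementwise N flipJ ∘L (H2N N).subtypeL)).comp_left (toH2N N)
    exact ⟨(h1.comp h2).isSchatten hp0 hωψ hsum, (h2.comp h1).isSchatten hp0 hψω hsum'⟩
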